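/- Let $m\ge 0$ and let $\mathbb S^m\subset\mathbb R^{m+1}$ be the Euclidean unit sphere. For a compact convex set $K\subset\mathbb R^{m+1}$ with the origin in its interior, let $\rho_K(x)=\max\{r\ge 0: rx\in K\}$ and $\vec\rho_K(x)=\rho_K(x)x\in\partial K$ for $x\in\mathbb S^m$; for $k\in\partial K$ let $\mathcal G_K(k)=\{n\in\mathbb S^m:\langle y-k,n\rangle\le 0\ \text{for all } y\in K\}$ be the set of unit outward normals at $k$; and for $\omega\subset\mathbb S^m$ let $(\mathcal G_K\circ\vec\rho_K)(\omega)=\bigcup_{x\in\omega}\mathcal G_K(\vec\rho_K(x))$. Given Borel probability measures $\lambda,\mu$ on $\mathbb S^m$, say that $K$ solves the Gauss image problem if $$\mu(\omega)=\lambda\big((\mathcal G_K\circ\vec\rho_K)(\omega)\big)\quad\text{for every Borel set }\omega\subset\mathbb S^m,$$ where $\lambda$ is understood as a complete measure. **Theorem 1.1.** Let $\lambda,\mu$ be Borel probability measures on $\mathbb S^m$, with $\lambda$ absolutely continuous with respect to the uniform measure. (i) Existence. Assume that no closed hemisphere $\{x\in\mathbb S^m:\langle u,x\rangle\ge 0\}$,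 $u\in\mathbb S^m$, has full $\mu$-measure, and that $\lambda,\mu$ satisfy the weak Aleksandrov condition: there is $\alpha\in(0,\pi/2)$ such that, for every closed set $F$ contained in a closed hemisphere, $$\mu(F)\le\lambda\big(F_{\pi/2-2\alpha}\big),\qquad F_{\pi/2-2\alpha}=\{n\in\mathbb S^m:\exists\,x\in F,\ \langle n,x\rangle>\cos(\pi/2-2\alpha)\}.$$ Then there is a compact convex set $K$ with the origin in its interior that solves the Gauss image problem; the sets $(\mathcal G_K\circ\vec\rho_K)(\omega)$, $\omega$ Borel, are measurable for the completion of $\lambda$. (ii) Uniqueness. If $K$ and $L$ are compact convex sets with the origin in their interiors that both solve the Gauss image problem for $\lambda$ and $\mu$, then for every Borel set $\omega\subset\mathbb S^m$ $$\lambda\Big((\mathcal G_K\circ\vec\rho_K)(\omega)\ \triangle\ (\mathcal G_L\circ\vec\rho_L)(\omega)\Big)=0 .$$ -/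

import Mathlib

open MeasureTheory

/-- The Euclidean space of dimension `m + 1`. -/
abbrev Space (m : ℕ) : Type := EuclideanSpace ℝ (Fin (m + 1))

/-- The unit sphere of the Euclidean space of dimension `m + 1`. -/
abbrev Sph (m : ℕ) : Type := Metric.sphere (0 : Space m) 1

/-- The rotation invariant surface measure on the sphere. It is a positive finite multiple of the
uniform probability measure, hence has the same null sets. -/
noncomputable def sphereMeasure (m : ℕ) : Measure (Sph m) :=
  (volume : Measure (Space m)).toSphere

/-- The closed hemisphere with pole `u`. -/
def closedHemisphere {m : ℕ} (u : Sph m) : Set (Sph m) :=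
  {x | 0 ≤ inner ℝ (u : Space m) (x : Space m)}

/-- A probability measure is concentrated on a closed hemisphere if some closed hemisphere
has full measure. -/
def ConcentratedOnClosedHemisphere {m : ℕ} (mu : Measure (Sph m)) : Prop :=
  ∃ u : Sph m, mu (closedHemisphere u) = 1

/-- The set `F_r` of points of the sphere at spherical distance less than `r` from a point of `F`,
for `0 ≤ r ≤ π`. -/
def sphericalEnlargement {m : ℕ} (F : Set (Sph m)) (r : ℝ) : Set (Sph m) :=
  {n | ∃ x ∈ F, Real.cos r < inner ℝ (n : Space m) (x : Space m)}

/-- The weak Aleksandrov condition. -/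
def WeakAleksandrov {m : ℕ} (lam mu : Measure (Sph m)) : Prop :=
  ∃ α ∈ Set.Ioo (0 : ℝ) (Real.pi / 2), ∀ F : Set (Sph m), IsClosed F →
    (∃ u : Sph m, F ⊆ closedHemisphere u) →
      mu F ≤ lam (sphericalEnlargement F (Real.pi / 2 - 2 * α))

/-- The radial function `ρ_K` of a convex body. -/
noncomputable def radialFunction {m : ℕ} (K : ConvexBody (Space m)) (x : Sph m) : ℝ :=
  sSup {r : ℝ | 0 ≤ r ∧ r • (x : Space m) ∈ K}

/-- The radial map `x ↦ ρ_K(x) x` from the sphere to the boundary of `K`. -/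
noncomputable def radialMap {m : ℕ} (K : ConvexBody (Space m)) (x : Sph m) : Space m :=
  radialFunction K x • (x : Space m)

/-- The multivalued Gauss map: the set of unit outward normal vectors to `K` at the boundary
point `k`. -/
def gaussMap {m : ℕ} (K : ConvexBody (Space m)) (k : Space m) : Set (Sph m) :=
  {n | ∀ y ∈ K, inner ℝ (y - k) (n : Space m) ≤ 0}

/-- The image of a set `ω` of directions under the multivalued map `G_K ∘ ρ_K`. -/
def gaussImage {m : ℕ} (K : ConvexBody (Space m)) (ω : Set (Sph m)) : Set (Sph m) :=
  ⋃ x ∈ ω, gaussMap K (radialMap K x)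

/-- `K` is a convex body with the origin in its interior that solves the Gauss image problem
`μ = λ ∘ (G_K ∘ ρ_K)`. (The value of `lam` at a set is that of its completion whenever the set is
measurable for the completion.) -/
def SolvesGaussImage {m : ℕ} (lam mu : Measure (Sph m)) (K : ConvexBody (Space m)) : Prop :=
  (0 : Space m) ∈ interior (K : Set (Space m)) ∧
    ∀ ω : Set (Sph m), MeasurableSet ω → mu ω = lam (gaussImage K ω)

/-! ### Null sets of directions and almost everywhere unique maximizers -/

open Filter Topology

/-! The problem is optimal transport for the cost `-log ⟪n, x⟫`, infinite when the inner product is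
not positive. A potential `ψ` generates the points `exp (ψ x) • x`, and the logarithm of their
support function is the transform of `ψ`. By Rademacher, almost every normal `n` has a single
contact direction `T n`; for `ψ = log ρ_K`, the Gauss image of `ω` is `T ⁻¹' ω` up to a null set.
Solving the problem thus means finding `ψ` with `mu = lam.map T`.

Existence: `dualEnergy` is minimized over potentials with values in `[0, R]`, where compactness is
available (`exists_minimizer`). The first variation gives `mu ≤ lam.map T` on `{ψ < R}` and the
reverse inequality on `{0 < ψ}`. The weak Aleksandrov condition, upgraded to all closed sets in
`exists_forall_isClosed_le`, bounds the mass of a superlevel set of `ψ` by the transported mass of a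
slightly lower one. By pigeonhole over a finite net, for large `R` some intermediate superlevel set
carries equal masses, and then the one-sided inequalities become equality (`exists_potential`).

Uniqueness: if two contact maps have the same image measure, both potentials minimize the same dual
functional. Equality of the energies forces each map into the contact sets of the other potential
(`ae_mem_contactSet_of_map_eq`). -/

/-- `toSphere` measures a set through the volume of the truncated cone over it, and here that cone
stays inside `N`. -/
theorem sphereMeasure_preimage_cone_eq_zero {m : ℕ} {N : Set (Space m)} (hN : MeasurableSet N)
    (hcone : ∀ c : ℝ, 0 < c → ∀ v ∈ N, c • v ∈ N) (h0 : volume N = 0) :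
    sphereMeasure m {n : Sph m | (n : Space m) ∈ N} = 0 := by
  have hs : MeasurableSet {n : Sph m | (n : Space m) ∈ N} := measurable_subtype_coe hN
  rw [sphereMeasure, Measure.toSphere_apply' _ hs]
  refine mul_eq_zero_of_right _ (measure_mono_null ?_ h0)
  rintro _ ⟨c, hc, _, ⟨n, hn, rfl⟩, rfl⟩
  exact hcone c hc.1 _ hn

/-- Almost every direction is maximized at a single point of a given bounded set. -/
theorem ae_unique_maximizer {m : ℕ} {A : Set (Space m)} (hA : Bornology.IsBounded A) :
    ∀ᵐ n : Sph m ∂(sphereMeasure m), ∀ y ∈ A, ∀ y' ∈ A,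
      (∀ z ∈ A, inner ℝ z (n : Space m) ≤ inner ℝ y (n : Space m)) →
      (∀ z ∈ A, inner ℝ z (n : Space m) ≤ inner ℝ y' (n : Space m)) → y = y' := by
  rcases A.eq_empty_or_nonempty with rfl | hne
  · simp
  obtain ⟨C, hC0, hC⟩ := hA.exists_pos_norm_le
  have : Nonempty A := hne.to_subtype
  let h : Space m → ℝ := fun v => ⨆ y : A, inner ℝ (y : Space m) v
  have hbdd : ∀ v, BddAbove (Set.range fun y : A => inner ℝ (y : Space m) v) := by
    intro v
    refine ⟨C * ‖v‖, ?_⟩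
    rintro _ ⟨y, rfl⟩
    exact (real_inner_le_norm _ _).trans
      (mul_le_mul_of_nonneg_right (hC _ y.2) (norm_nonneg _))
  have hlip : LipschitzWith C.toNNReal h := by
    refine LipschitzWith.of_le_add_mul _ fun v w => ?_
    refine ciSup_le fun y => ?_
    have h1 : inner ℝ (y : Space m) w ≤ h w := le_ciSup (hbdd w) y
    have h2 : inner ℝ (y : Space m) (v - w) ≤ C * ‖v - w‖ :=
      (real_inner_le_norm _ _).trans
        (mul_le_mul_of_nonneg_right (hC _ y.2) (norm_nonneg _))
    rw [inner_sub_right] at h2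
    rw [dist_eq_norm, Real.coe_toNNReal _ hC0.le]
    linarith
  have hhom : ∀ c : ℝ, 0 < c → ∀ v, h (c • v) = c * h v := by
    intro c hc v
    simp only [h, inner_smul_right]
    rw [Real.mul_iSup_of_nonneg hc.le]
  -- Homogeneity of `h` makes its non-differentiability set a cone, so Rademacher's theorem passes
  -- to the sphere.
  have hnull : sphereMeasure m {n : Sph m | (n : Space m) ∈ {v | DifferentiableAt ℝ h v}ᶜ} = 0 := by
    refine sphereMeasure_preimage_cone_eq_zero (measurableSet_of_differentiableAt ℝ h).compl ?_
      (ae_iff.1 hlip.ae_differentiableAt)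
    intro c hc v hv hd
    refine hv ?_
    have e : h = fun w => c⁻¹ * h (c • w) := by
      funext w
      rw [hhom c hc, inv_mul_cancel_left₀ hc.ne']
    change DifferentiableAt ℝ h v
    rw [e]
    exact ((hd.comp v (differentiableAt_id.const_smul c)).const_mul _)
  have hae : ∀ᵐ n : Sph m ∂(sphereMeasure m), DifferentiableAt ℝ h (n : Space m) := by
    rw [ae_iff]; exact hnull
  filter_upwards [hae] with n hn
  -- The linear function of a maximizer `y` touches `h` from below at `n`, so the gradient of `h`
  -- there is `y`.
  have key : ∀ y ∈ A, (∀ z ∈ A, inner ℝ z (n : Space m) ≤ inner ℝ y (n : Space m)) →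
      fderiv ℝ h (n : Space m) = innerSL ℝ y := by
    intro y hy hmax
    have hmin : IsLocalMin (fun v => h v - innerSL ℝ y v) (n : Space m) := by
      refine Eventually.of_forall fun v => ?_
      have h1 : h (n : Space m) ≤ inner ℝ y (n : Space m) := ciSup_le fun z => hmax _ z.2
      have h2 : inner ℝ y v ≤ h v := le_ciSup (hbdd v) ⟨y, hy⟩
      simp only [innerSL_apply_apply]
      linarith
    have h3 := hmin.fderiv_eq_zero
    rw [fderiv_fun_sub hn (innerSL ℝ y).differentiableAt, ContinuousLinearMap.fderiv] at h3
    exact sub_eq_zero.1 h3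
  intro y hy y' hy' h1 h2
  have h3 := (key y hy h1).symm.trans (key y' hy' h2)
  refine ext_inner_right ℝ fun v => ?_
  simpa using congrArg (fun L => L v) h3

theorem sphereMeasure_hyperplane {m : ℕ} (x : Sph m) :
    sphereMeasure m {n : Sph m | inner ℝ (n : Space m) (x : Space m) = 0} = 0 := by
  refine sphereMeasure_preimage_cone_eq_zero
    (N := {v : Space m | inner ℝ v (x : Space m) = 0}) ?_ ?_ ?_
  · exact (isClosed_eq (by fun_prop) continuous_const).measurableSet
  · intro c _ v hv
    simp only [Set.mem_ofPred_eq] at hv ⊢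
    rw [inner_smul_left, hv, mul_zero]
  · have hx : (x : Space m) ≠ 0 := ne_zero_of_mem_unit_sphere x
    have e : {v : Space m | inner ℝ v (x : Space m) = 0} =
        ((LinearMap.ker (innerSL ℝ (x : Space m)).toLinearMap : Submodule ℝ (Space m)) :
          Set (Space m)) := by
      ext v
      simp [real_inner_comm]
    rw [e]
    refine Measure.addHaar_submodule _ _ fun htop => hx ?_
    have : (x : Space m) ∈ LinearMap.ker (innerSL ℝ (x : Space m)).toLinearMap :=
      htop ▸ Submodule.mem_top
    simp at this

/-! ### From the weak Aleksandrov condition to arbitrary closed sets -/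

/-- Continuity from above settles a single `u`, the Lipschitz bound extends this to a ball, and
compactness makes it uniform. It is applied to hemispheres for `mu` and to slabs for `lam`. -/
theorem exists_pos_uniform_sublevel_lt {X Y : Type*} [PseudoMetricSpace X] [CompactSpace X]
    [Nonempty X] [MeasurableSpace Y] (nu : Measure Y) [IsFiniteMeasure nu] (f : X → Y → ℝ)
    (hf : ∀ u v y, |f u y - f v y| ≤ dist u v) (hm : ∀ u, Measurable (f u)) {c : ENNReal}
    (h : ∀ u, nu {y | f u y ≤ 0} < c) :
    ∃ s > 0, ∃ c' < c, ∀ u, nu {y | f u y ≤ s} ≤ c' := by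
  have key : ∃ s > 0, ∃ c' < c, ∀ u ∈ (Set.univ : Set X), nu {y | f u y ≤ s} ≤ c' := by
    refine isCompact_univ.induction_on (p := fun U => ∃ s > 0, ∃ c' < c,
        ∀ u ∈ U, nu {y | f u y ≤ s} ≤ c')
      
      ⟨1, one_pos, 0, pos_of_gt (h (Classical.choice ‹Nonempty X›)), by simp⟩ ?_ ?_ ?_
    · rintro U V hUV ⟨s, hs, c', hc', H⟩
      exact ⟨s, hs, c', hc', fun u hu => H u (hUV hu)⟩
    · rintro U V ⟨s, hs, c₁, hc₁, H⟩ ⟨t, ht, c₂, hc₂, H'⟩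
      refine ⟨min s t, lt_min hs ht, max c₁ c₂, max_lt hc₁ hc₂, ?_⟩
      rintro u (hu | hu)
      · exact (measure_mono fun y (hy : f u y ≤ _) => hy.trans (min_le_left _ _)).trans
          ((H u hu).trans (le_max_left _ _))
      · exact (measure_mono fun y (hy : f u y ≤ _) => hy.trans (min_le_right _ _)).trans
          ((H' u hu).trans (le_max_right _ _))
    · intro u _
      have hlim : Tendsto (fun k : ℕ => nu {y | f u y ≤ 1 / ((k : ℝ) + 1)}) atTop
          (𝓝 (nu (⋂ k : ℕ, {y | f u y ≤ 1 / ((k : ℝ) + 1)}))) := by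
        refine tendsto_measure_iInter_atTop
          (fun k => (measurableSet_le (hm u) measurable_const).nullMeasurableSet) ?_
          ⟨0, measure_ne_top _ _⟩
        intro i j hij y (hy : f u y ≤ _)
        exact hy.trans (Nat.one_div_le_one_div hij)
      have hint : (⋂ k : ℕ, {y | f u y ≤ 1 / ((k : ℝ) + 1)}) ⊆ {y | f u y ≤ 0} := by
        intro y hy
        rw [Set.mem_iInter] at hy
        have hy' : ∀ k : ℕ, f u y ≤ 1 / ((k : ℝ) + 1) := hy
        exact ge_of_tendsto' tendsto_one_div_add_atTop_nhds_zero_nat hy'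
      obtain ⟨k, hk⟩ := (hlim.eventually_lt_const ((measure_mono hint).trans_lt (h u))).exists
      have hk0 : 0 < 1 / ((k : ℝ) + 1) := Nat.one_div_pos_of_nat
      -- Half the level is kept for `s` and the other half pays for moving from `u` to `v`.
      refine ⟨Metric.ball u (1 / ((k : ℝ) + 1) / 2),
        mem_nhdsWithin_of_mem_nhds (Metric.ball_mem_nhds _ (half_pos hk0)),
        1 / ((k : ℝ) + 1) / 2, half_pos hk0, _, hk, fun v hv => ?_⟩
      refine measure_mono fun y (hy : f v y ≤ _) => ?_
      have h1 := hf u v y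
      have h2 : dist v u < _ := hv
      rw [dist_comm] at h2
      have := (abs_le.1 h1).2
      change f u y ≤ _
      linarith
  obtain ⟨s, hs, c', hc', H⟩ := key
  exact ⟨s, hs, c', hc', fun u => H u trivial⟩

instance Sph.instNonempty {m : ℕ} : Nonempty (Sph m) :=
  (NormedSpace.sphere_nonempty.2 zero_le_one).to_subtype

theorem Sph.norm_eq {m : ℕ} (x : Sph m) : ‖(x : Space m)‖ = 1 := norm_eq_of_mem_sphere x

theorem Sph.inner_self {m : ℕ} (x : Sph m) : inner ℝ (x : Space m) (x : Space m) = 1 := by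
  rw [real_inner_self_eq_norm_sq, Sph.norm_eq, one_pow]

theorem Sph.inner_le_one {m : ℕ} (x y : Sph m) : inner ℝ (x : Space m) (y : Space m) ≤ 1 := by
  simpa [Sph.norm_eq] using real_inner_le_norm (x : Space m) (y : Space m)

theorem Sph.abs_inner_sub_inner_le {m : ℕ} (x y z : Sph m) :
    |inner ℝ (x : Space m) (z : Space m) - inner ℝ (y : Space m) (z : Space m)| ≤ dist x y := by
  rw [← inner_sub_left, Subtype.dist_eq, dist_eq_norm]
  simpa [Sph.norm_eq] using abs_real_inner_le_norm ((x : Space m) - y) (z : Space m)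

/-- If the origin is close to the convex hull of a set of unit vectors, then the directions having
a small inner product with all of them lie in a thin slab. -/
theorem exists_slab_of_mem_closure_convexHull {m : ℕ} {F : Set (Sph m)}
    (h0 : (0 : Space m) ∈ closure (convexHull ℝ ((↑) '' F : Set (Space m)))) {d : ℝ} (hd : 0 < d) :
    ∃ x ∈ F, ∀ n : Sph m, (∀ y ∈ F, inner ℝ (n : Space m) (y : Space m) ≤ d) →
      |inner ℝ (x : Space m) (n : Space m)| ≤ 2 * (m + 2) * d := by
  obtain ⟨c, hc, hcd⟩ := Metric.mem_closure_iff.1 h0 d hd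
  rw [dist_zero_left] at hcd
  obtain ⟨ι, _, z, w, hz, haff, hw, hw1, rfl⟩ := eq_pos_convex_span_of_mem_convexHull hc
  have hcard : (Fintype.card ι : ℝ) ≤ m + 2 := by
    have := haff.card_le_finrank_succ.trans (Nat.succ_le_succ (Submodule.finrank_le _))
    rw [finrank_euclideanSpace_fin] at this
    exact_mod_cast this
  have hne : (Finset.univ : Finset ι).Nonempty := by
    rw [Finset.nonempty_iff_ne_empty]
    rintro he
    rw [he, Finset.sum_empty] at hw1
    exact zero_ne_one hw1
  -- Carathéodory leaves at most `m + 2` points, so one weight is at least the average `1 / (m +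
  -- 2)`.
  obtain ⟨i, -, hi⟩ : ∃ i ∈ (Finset.univ : Finset ι), (1 : ℝ) / (m + 2) ≤ w i := by
    refine Finset.exists_le_of_sum_le hne ?_
    rw [hw1, Finset.sum_const, nsmul_eq_mul, Finset.card_univ, mul_one_div]
    exact (div_le_one (by positivity)).2 hcard
  obtain ⟨x, hxF, hx⟩ := hz (Set.mem_range_self i)
  refine ⟨x, hxF, fun n hn => ?_⟩
  have hm2 : (0 : ℝ) < m + 2 := by positivity
  have hzn : ∀ j, inner ℝ (z j) (n : Space m) ≤ d := by
    intro j
    obtain ⟨y, hyF, hy⟩ := hz (Set.mem_range_self j)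
    rw [← hy, real_inner_comm]
    exact hn y hyF
  have hsum : ∑ j, w j * inner ℝ (z j) (n : Space m) ≥ -d := by
    have e : ∑ j, w j * inner ℝ (z j) (n : Space m) = inner ℝ (∑ j, w j • z j) (n : Space m) := by
      rw [sum_inner]; simp only [inner_smul_left, RCLike.conj_to_real]
    rw [e]
    have := abs_real_inner_le_norm (∑ j, w j • z j) (n : Space m)
    rw [Sph.norm_eq, mul_one] at this
    linarith [(abs_le.1 this).1]
  have hrest : ∑ j, w j * inner ℝ (z j) (n : Space m) ≤ w i * inner ℝ (z i) (n : Space m) + d := by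
    classical
    rw [← Finset.add_sum_erase _ _ (Finset.mem_univ i)]
    refine add_le_add_right ?_ _
    calc ∑ j ∈ Finset.univ.erase i, w j * inner ℝ (z j) (n : Space m)
        ≤ ∑ j ∈ Finset.univ.erase i, w j * d :=
          Finset.sum_le_sum fun j _ => mul_le_mul_of_nonneg_left (hzn j) (hw j).le
      _ ≤ ∑ j, w j * d := Finset.sum_le_sum_of_subset_of_nonneg (Finset.erase_subset _ _)
          fun j _ _ => mul_nonneg (hw j).le hd.le
      _ = d := by rw [← Finset.sum_mul, hw1, one_mul]
  rw [hx, abs_le]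
  have h1 : -(2 * d) ≤ w i * inner ℝ (z i) (n : Space m) := by linarith
  constructor
  · by_contra! hlt
    have hneg : inner ℝ (z i) (n : Space m) < 0 := by nlinarith
    have h2 : w i * inner ℝ (z i) (n : Space m) ≤ 1 / (m + 2) * inner ℝ (z i) (n : Space m) :=
      mul_le_mul_of_nonpos_right hi hneg.le
    have h3 : 1 / ((m : ℝ) + 2) * inner ℝ (z i) (n : Space m) < -(2 * d) := by
      rw [one_div, inv_mul_lt_iff₀ hm2]; linarith
    linarith
  · have h4 := hzn i
    nlinarith

/-- The weak Aleksandrov condition yields a condition of the same kind for all closed sets. -/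
theorem exists_forall_isClosed_le {m : ℕ} {lam mu : Measure (Sph m)}
    [IsProbabilityMeasure lam] [IsProbabilityMeasure mu] (hlam : lam ≪ sphereMeasure m)
    (hmu : ¬ ConcentratedOnClosedHemisphere mu) (hA : WeakAleksandrov lam mu) :
    ∃ d > 0, ∀ F : Set (Sph m), IsClosed F →
      mu F ≤ lam {n | ∃ x ∈ F, d < inner ℝ (n : Space m) (x : Space m)} := by
  obtain ⟨α, hα, hA⟩ := hA
  have hcos : 0 < Real.cos (Real.pi / 2 - 2 * α) :=
    Real.cos_pos_of_mem_Ioo ⟨by linarith [hα.2], by linarith [hα.1, Real.pi_pos]⟩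
  obtain ⟨s, hs, c, hc, hsmu⟩ := exists_pos_uniform_sublevel_lt mu
    (fun u x : Sph m => inner ℝ (u : Space m) (x : Space m))
    (fun u v y => Sph.abs_inner_sub_inner_le u v y)
    (fun u => by fun_prop) (c := 1) (by
      intro u
      refine lt_of_le_of_ne prob_le_one fun h => hmu ⟨-u, ?_⟩
      rw [← h]
      congr 1
      ext x
      simp [closedHemisphere])
  -- `η` is mass that `mu` always leaves outside a slightly enlarged hemisphere; below, slabs are
  -- taken so thin that their `lam`-mass is less than `η`.
  obtain ⟨η, hη, hηmu⟩ : ∃ η : ENNReal, 0 < η ∧ ∀ u : Sph m,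
      mu {x | inner ℝ (u : Space m) (x : Space m) ≤ s} + η ≤ 1 :=
    ⟨1 - c, tsub_pos_of_lt hc, fun u => (add_le_add_left (hsmu u) _).trans
      (add_tsub_cancel_of_le hc.le).le⟩
  obtain ⟨t, ht, c', hc', htlam⟩ := exists_pos_uniform_sublevel_lt lam
    (fun u x : Sph m => |inner ℝ (u : Space m) (x : Space m)|)
    (fun u v y => (abs_abs_sub_abs_le _ _).trans (Sph.abs_inner_sub_inner_le u v y))
    (fun u => by fun_prop) (c := η) (by
      intro u
      convert hη
      refine hlam (measure_mono_null ?_ (sphereMeasure_hyperplane u))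
      intro x hx
      rw [Set.mem_ofPred_eq, abs_nonpos_iff, real_inner_comm] at hx
      exact hx)
  have hm2 : (0 : ℝ) < 2 * (m + 2) := by positivity
  refine ⟨min (Real.cos (Real.pi / 2 - 2 * α)) (min s (t / (2 * (m + 2)))),
    lt_min hcos (lt_min hs (div_pos ht hm2)), fun F hF => ?_⟩
  set d := min (Real.cos (Real.pi / 2 - 2 * α)) (min s (t / (2 * (m + 2))))
  have hd : 0 < d := lt_min hcos (lt_min hs (div_pos ht hm2))
  -- If the origin is separated from the hull, `F` lies in a hemisphere and the hypothesis applies.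
  -- Otherwise the directions missed by the enlargement form a set inside a thin slab, and if there
  -- are any, `F` itself misses `mu`-mass `η`.
  by_cases h0 : (0 : Space m) ∈ closure (convexHull ℝ ((↑) '' F : Set (Space m)))
  · by_cases hall : ∃ n : Sph m, ∀ x ∈ F, inner ℝ (n : Space m) (x : Space m) ≤ d
    · obtain ⟨n₀, hn₀⟩ := hall
      obtain ⟨x, -, hx⟩ := exists_slab_of_mem_closure_convexHull h0 hd
      have h1 : mu F + η ≤ 1 := by
        refine le_trans (add_le_add_left (measure_mono fun y hy => ?_) _) (hηmu n₀)
        exact (hn₀ y hy).trans ((min_le_right _ _).trans (min_le_left _ _))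
      have h2 : lam {n | ∃ x ∈ F, d < inner ℝ (n : Space m) (x : Space m)}ᶜ ≤ η := by
        refine le_trans (measure_mono fun n hn => ?_) ((htlam x).trans hc'.le)
        have hn' : ∀ y ∈ F, inner ℝ (n : Space m) (y : Space m) ≤ d := by
          intro y hy
          by_contra! hlt
          exact hn ⟨y, hy, hlt⟩
        refine (hx n hn').trans ?_
        rw [← le_div_iff₀' hm2]
        exact (min_le_right _ _).trans (min_le_right _ _)
      have hη1 : η ≠ ⊤ := ne_top_of_le_ne_top ENNReal.one_ne_top (le_add_self.trans h1)
      have h3 : 1 ≤ lam {n | ∃ x ∈ F, d < inner ℝ (n : Space m) (x : Space m)} + η := by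
        calc (1 : ENNReal) = lam Set.univ := measure_univ.symm
          _ ≤ _ := by
            rw [← Set.union_compl_self {n : Sph m | ∃ x ∈ F, d < inner ℝ (n : Space m) (x : Space m)}]
            exact (measure_union_le _ _).trans (add_le_add_right h2 _)
      exact ENNReal.le_of_add_le_add_right hη1 (h1.trans h3)
    · push Not at hall
      have : {n : Sph m | ∃ x ∈ F, d < inner ℝ (n : Space m) (x : Space m)} = Set.univ :=
        Set.eq_univ_of_forall hall
      rw [this, measure_univ]
      exact prob_le_one
  · obtain ⟨f, u, hu1, hu2⟩ := geometric_hahn_banach_point_closed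
      (convex_convexHull ℝ _).closure isClosed_closure h0
    have hu0 : 0 < u := by simpa using hu1
    refine (hA F hF ?_).trans (measure_mono ?_)
    · set v := (InnerProductSpace.toDual ℝ (Space m)).symm f
      have hv : ∀ x, inner ℝ v x = f x := fun x => by simp [v]
      by_cases hv0 : v = 0
      · rcases F.eq_empty_or_nonempty with rfl | ⟨x, hx⟩
        · exact ⟨Classical.arbitrary _, Set.empty_subset _⟩
        · have := hu2 x (subset_closure (subset_convexHull _ _ ⟨x, hx, rfl⟩))
          rw [← hv, hv0, inner_zero_left] at this
          exact absurd this (not_lt.2 hu0.le)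
      · refine ⟨⟨‖v‖⁻¹ • v, by simp [norm_smul, hv0]⟩, fun x hx => ?_⟩
        have := hu2 x (subset_closure (subset_convexHull _ _ ⟨x, hx, rfl⟩))
        change 0 ≤ inner ℝ (‖v‖⁻¹ • v) (x : Space m)
        rw [inner_smul_left, hv]
        exact mul_nonneg (by simp) (hu0.le.trans this.le)
    · rintro n ⟨x, hx, hn⟩
      exact ⟨x, hx, (min_le_left _ _).trans_lt hn⟩

/-! ### Support functions, contact sets and the logarithmic transform -/

/-- The support function of the convex hull of the points `exp (ψ x) • x`. -/
noncomputable def supportOf {m : ℕ} (ψ : C(Sph m, ℝ)) (n : Sph m) : ℝ :=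
  ⨆ x : Sph m, Real.exp (ψ x) * inner ℝ (x : Space m) (n : Space m)

/-- The directions of the points `exp (ψ x) • x` that are extremal in the direction `n`. -/
def contactSet {m : ℕ} (ψ : C(Sph m, ℝ)) (n : Sph m) : Set (Sph m) :=
  {x | Real.exp (ψ x) * inner ℝ (x : Space m) (n : Space m) = supportOf ψ n}

/-- This is the transform of `ψ` for the cost `-log ⟪n, x⟫`: the supremum is positive, so only `x`
with positive inner product compete. -/
noncomputable def logSupport {m : ℕ} (ψ : C(Sph m, ℝ)) (n : Sph m) : ℝ :=
  Real.log (supportOf ψ n)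

section support

variable {m : ℕ} (ψ ψ' : C(Sph m, ℝ))

theorem le_supportOf (x n : Sph m) :
    Real.exp (ψ x) * inner ℝ (x : Space m) (n : Space m) ≤ supportOf ψ n := by
  have hc : Continuous fun x : Sph m => Real.exp (ψ x) * inner ℝ (x : Space m) (n : Space m) := by
    fun_prop
  exact le_ciSup (isCompact_range hc).bddAbove x

theorem contactSet_nonempty (n : Sph m) : (contactSet ψ n).Nonempty := by
  have hc : Continuous fun x : Sph m => Real.exp (ψ x) * inner ℝ (x : Space m) (n : Space m) := by
    fun_prop
  obtain ⟨x, -, hx⟩ := isCompact_univ.exists_isMaxOn Set.univ_nonempty hc.continuousOn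
  exact ⟨x, le_antisymm (le_supportOf ψ x n) (ciSup_le fun y => hx (Set.mem_univ y))⟩

theorem exp_le_supportOf (n : Sph m) : Real.exp (ψ n) ≤ supportOf ψ n := by
  simpa [Sph.inner_self] using le_supportOf ψ n n

theorem supportOf_pos (n : Sph m) : 0 < supportOf ψ n :=
  (Real.exp_pos _).trans_le (exp_le_supportOf ψ n)

variable {ψ ψ'}

theorem inner_pos_of_mem_contactSet {x n : Sph m} (hx : x ∈ contactSet ψ n) :
    0 < inner ℝ (x : Space m) (n : Space m) := by
  have h : Real.exp (ψ x) * inner ℝ (x : Space m) (n : Space m) = supportOf ψ n := hx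
  exact pos_of_mul_pos_right (h ▸ supportOf_pos ψ n) (Real.exp_pos _).le

theorem logSupport_eq_of_mem_contactSet {x n : Sph m} (hx : x ∈ contactSet ψ n) :
    logSupport ψ n = ψ x + Real.log (inner ℝ (x : Space m) (n : Space m)) := by
  have h : Real.exp (ψ x) * inner ℝ (x : Space m) (n : Space m) = supportOf ψ n := hx
  rw [logSupport, ← h, Real.log_mul (Real.exp_pos _).ne' (inner_pos_of_mem_contactSet hx).ne',
    Real.log_exp]

variable (ψ) in
theorem le_logSupport {x n : Sph m} (h : 0 < inner ℝ (x : Space m) (n : Space m)) :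
    ψ x + Real.log (inner ℝ (x : Space m) (n : Space m)) ≤ logSupport ψ n := by
  rw [logSupport, Real.le_log_iff_exp_le (supportOf_pos ψ n), Real.exp_add, Real.exp_log h]
  exact le_supportOf ψ x n

theorem mem_contactSet_of_logSupport_le {x n : Sph m} (h : 0 < inner ℝ (x : Space m) (n : Space m))
    (hle : logSupport ψ n ≤ ψ x + Real.log (inner ℝ (x : Space m) (n : Space m))) :
    x ∈ contactSet ψ n := by
  refine le_antisymm (le_supportOf ψ x n) ?_
  rwa [logSupport, Real.log_le_iff_le_exp (supportOf_pos ψ n), Real.exp_add, Real.exp_log h] at hle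

theorem logSupport_le {n : Sph m} {c : ℝ} (h : ∀ x : Sph m, 0 < inner ℝ (x : Space m) (n : Space m) →
    ψ x + Real.log (inner ℝ (x : Space m) (n : Space m)) ≤ c) : logSupport ψ n ≤ c := by
  obtain ⟨x, hx⟩ := contactSet_nonempty ψ n
  rw [logSupport_eq_of_mem_contactSet hx]
  exact h x (inner_pos_of_mem_contactSet hx)

theorem logSupport_le_add {c : ℝ} (h : ∀ x, ψ x ≤ ψ' x + c) (n : Sph m) :
    logSupport ψ n ≤ logSupport ψ' n + c :=
  logSupport_le fun x hx => by linarith [h x, le_logSupport ψ' hx]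

variable (ψ) in
theorem self_le_logSupport (n : Sph m) : ψ n ≤ logSupport ψ n := by
  rw [logSupport, Real.le_log_iff_exp_le (supportOf_pos ψ n)]
  exact exp_le_supportOf ψ n

theorem logSupport_le_of_le {R : ℝ} (h : ∀ x, ψ x ≤ R) (n : Sph m) : logSupport ψ n ≤ R :=
  logSupport_le fun x hx => by
    have h1 : inner ℝ (x : Space m) (n : Space m) ≤ 1 := Sph.inner_le_one x n
    linarith [h x, Real.log_nonpos hx.le h1]

variable (ψ) in
theorem continuous_supportOf : Continuous (supportOf ψ) := by
  obtain ⟨C, hC⟩ := (isCompact_range (f := fun x => Real.exp (ψ x)) (by fun_prop)).bddAbove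
  have hC' : ∀ x, Real.exp (ψ x) ≤ C := fun x => hC ⟨x, rfl⟩
  refine (LipschitzWith.of_le_add_mul C.toNNReal fun n n' => ?_).continuous
  obtain ⟨x, hx⟩ := contactSet_nonempty ψ n
  have h0 : Real.exp (ψ x) * inner ℝ (x : Space m) (n : Space m) = supportOf ψ n := hx
  have h1 := le_supportOf ψ x n'
  have h2 := (abs_le.1 (Sph.abs_inner_sub_inner_le n n' x)).2
  rw [real_inner_comm, real_inner_comm (x : Space m)] at h2
  have hC0 : 0 ≤ C := (Real.exp_pos _).le.trans (hC' n)
  rw [Real.coe_toNNReal _ hC0]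
  have h3 : Real.exp (ψ x) * (inner ℝ (x : Space m) (n : Space m) -
      inner ℝ (x : Space m) (n' : Space m)) ≤ C * dist n n' :=
    (mul_le_mul_of_nonneg_left h2 (Real.exp_pos _).le).trans
      (mul_le_mul_of_nonneg_right (hC' x) dist_nonneg)
  linarith

variable (ψ) in
theorem continuous_logSupport : Continuous (logSupport ψ) :=
  (continuous_supportOf ψ).log fun n => (supportOf_pos ψ n).ne'

end support

/-! ### The dual functional and its constrained minimizers -/

theorem integrable_of_continuous {m : ℕ} (nu : Measure (Sph m)) [IsFiniteMeasure nu] {f : Sph m → ℝ}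
    (hf : Continuous f) : Integrable f nu :=
  hf.integrable_of_hasCompactSupport (HasCompactSupport.of_compactSpace f)

/-- The functional of the dual problem of optimal transport for the cost `- log ⟪n, x⟫`. -/
noncomputable def dualEnergy {m : ℕ} (lam mu : Measure (Sph m)) (ψ : C(Sph m, ℝ)) : ℝ :=
  ∫ n, logSupport ψ n ∂lam - ∫ x, ψ x ∂mu

section energy

variable {m : ℕ} (lam mu : Measure (Sph m)) [IsProbabilityMeasure lam] [IsProbabilityMeasure mu]

theorem dualEnergy_le_add {ψ ψ' : C(Sph m, ℝ)} {a b : ℝ} (ha : ∀ x, ψ x ≤ ψ' x + a)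
    (hb : ∀ x, ψ' x ≤ ψ x + b) : dualEnergy lam mu ψ ≤ dualEnergy lam mu ψ' + (a + b) := by
  have h1 : ∫ n, logSupport ψ n ∂lam ≤ ∫ n, logSupport ψ' n + a ∂lam :=
    integral_mono (integrable_of_continuous _ (continuous_logSupport ψ))
      (integrable_of_continuous _ ((continuous_logSupport ψ').add continuous_const))
      fun n => logSupport_le_add ha n
  have h2 : ∫ n, ψ' n ∂mu ≤ ∫ n, ψ n + b ∂mu :=
    integral_mono (integrable_of_continuous _ ψ'.continuous)
      (integrable_of_continuous _ (ψ.continuous.add continuous_const)) hb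
  rw [integral_add (integrable_of_continuous _ (continuous_logSupport ψ')) (integrable_const _)] at h1
  rw [integral_add (integrable_of_continuous _ ψ.continuous) (integrable_const _)] at h2
  simp only [integral_const, probReal_univ, one_smul] at h1 h2
  rw [dualEnergy, dualEnergy]
  linarith

theorem continuous_dualEnergy : Continuous (dualEnergy lam mu) := by
  refine (LipschitzWith.of_le_add_mul 2 fun ψ ψ' => ?_).continuous
  have h : ∀ x, |ψ x - ψ' x| ≤ dist ψ ψ' := fun x => by
    rw [← Real.dist_eq]
    exact ContinuousMap.dist_apply_le_dist x
  refine (dualEnergy_le_add lam mu (ψ' := ψ') (a := dist ψ ψ') (b := dist ψ ψ') ?_ ?_).trans_eq ?_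
  · intro x; linarith [(abs_le.1 (h x)).2]
  · intro x; linarith [(abs_le.1 (h x)).1]
  · push_cast; ring

/-- Every bounded potential can be improved to one that is Lipschitz with a fixed constant. -/
theorem exists_lipschitz_improvement {R : ℝ} {ψ : C(Sph m, ℝ)}
    (hψ : ∀ x, ψ x ∈ Set.Icc 0 R) :
    ∃ ψ' : C(Sph m, ℝ), (∀ x, ψ' x ∈ Set.Icc 0 R) ∧ LipschitzWith (Real.exp R).toNNReal ψ' ∧
      dualEnergy lam mu ψ' ≤ dualEnergy lam mu ψ := by
  have hφ0 : ∀ n, 0 ≤ logSupport ψ n := fun n => (hψ n).1.trans (self_le_logSupport ψ n)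
  have hφR : ∀ n, logSupport ψ n ≤ R := logSupport_le_of_le fun x => (hψ x).2
  -- The infimum over `n` is the double transform with the cost cut off at `R`. The cutoff makes it
  -- Lipschitz, yet keeps it above `ψ`, since `logSupport ψ ≥ 0` and `ψ ≤ R`.
  let k : Sph m → Sph m → ℝ := fun x n =>
    logSupport ψ n - Real.log (max (inner ℝ (x : Space m) (n : Space m)) (Real.exp (-R)))
  have hpos : ∀ x n : Sph m, 0 < max (inner ℝ (x : Space m) (n : Space m)) (Real.exp (-R)) :=
    fun x n => lt_max_of_lt_right (Real.exp_pos _)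
  have hR0 : 0 ≤ R := (hψ (Classical.arbitrary _)).1.trans (hψ _).2
  have hk0 : ∀ x n, 0 ≤ k x n := by
    intro x n
    have : Real.log (max (inner ℝ (x : Space m) (n : Space m)) (Real.exp (-R))) ≤ 0 :=
      Real.log_nonpos (hpos x n).le
        (max_le (Sph.inner_le_one x n) (Real.exp_le_one_iff.2 (by linarith)))
    linarith [hφ0 n]
  have hbdd : ∀ x, BddBelow (Set.range (k x)) := fun x => ⟨0, by rintro _ ⟨n, rfl⟩; exact hk0 x n⟩
  have hlipk : ∀ x y n, k x n ≤ k y n + Real.exp R * dist x y := by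
    intro x y n
    have h1 : max (inner ℝ (y : Space m) (n : Space m)) (Real.exp (-R)) ≤
        max (inner ℝ (x : Space m) (n : Space m)) (Real.exp (-R)) + dist x y := by
      have h := (abs_le.1 (Sph.abs_inner_sub_inner_le x y n)).1
      refine max_le ?_ ?_
      · linarith [le_max_left (inner ℝ (x : Space m) (n : Space m)) (Real.exp (-R))]
      · linarith [le_max_right (inner ℝ (x : Space m) (n : Space m)) (Real.exp (-R)),
          dist_nonneg (x := x) (y := y)]
    set a := max (inner ℝ (x : Space m) (n : Space m)) (Real.exp (-R))
    set b := max (inner ℝ (y : Space m) (n : Space m)) (Real.exp (-R))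
    have ha0 : 0 < a := hpos x n
    have hb0 : 0 < b := hpos y n
    have h2 : Real.log b - Real.log a ≤ Real.exp R * dist x y := by
      rw [← Real.log_div hb0.ne' ha0.ne']
      refine (Real.log_le_sub_one_of_pos (div_pos hb0 ha0)).trans ?_
      rw [div_sub_one ha0.ne', div_le_iff₀ ha0]
      have h3 : 1 ≤ Real.exp R * a := by
        calc (1 : ℝ) = Real.exp R * Real.exp (-R) := by rw [← Real.exp_add]; simp
          _ ≤ _ := mul_le_mul_of_nonneg_left (le_max_right _ _) (Real.exp_pos _).le
      nlinarith [dist_nonneg (x := x) (y := y)]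
    change logSupport ψ n - Real.log a ≤ logSupport ψ n - Real.log b + _
    linarith
  have hlip : LipschitzWith (Real.exp R).toNNReal fun x => ⨅ n, k x n := by
    refine LipschitzWith.of_le_add_mul _ fun x y => ?_
    rw [Real.coe_toNNReal _ (Real.exp_pos _).le, ← sub_le_iff_le_add]
    exact le_ciInf fun n => by
      rw [sub_le_iff_le_add]
      exact (ciInf_le (hbdd x) n).trans (hlipk x y n)
  refine ⟨⟨fun x => ⨅ n, k x n, hlip.continuous⟩, fun x => ⟨le_ciInf (hk0 x), ?_⟩, hlip, ?_⟩
  · refine (ciInf_le (hbdd x) x).trans ?_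
    have : max (inner ℝ (x : Space m) (x : Space m)) (Real.exp (-R)) = 1 := by
      rw [Sph.inner_self]
      exact max_eq_left (Real.exp_le_one_iff.2 (by linarith))
    simp only [k, this, Real.log_one, sub_zero]
    exact hφR x
  · set ψ' : C(Sph m, ℝ) := ⟨fun x => ⨅ n, k x n, hlip.continuous⟩
    have h1 : ∀ x, ψ x ≤ ψ' x := by
      intro x
      refine le_ciInf fun n => ?_
      simp only [k]
      rcases le_total (inner ℝ (x : Space m) (n : Space m)) (Real.exp (-R)) with h | h
      · rw [max_eq_right h, Real.log_exp]
        linarith [hφ0 n, (hψ x).2]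
      · rw [max_eq_left h]
        linarith [le_logSupport ψ ((Real.exp_pos _).trans_le h)]
    have h2 : ∀ n, logSupport ψ' n ≤ logSupport ψ n := by
      refine fun n => logSupport_le fun x hx => ?_
      have h3 : ψ' x ≤ k x n := ciInf_le (hbdd x) n
      have h4 := Real.log_le_log hx (le_max_left (inner ℝ (x : Space m) (n : Space m)) (Real.exp (-R)))
      simp only [k] at h3
      linarith
    refine sub_le_sub (integral_mono (integrable_of_continuous _ (continuous_logSupport _))
      (integrable_of_continuous _ (continuous_logSupport _)) h2)
      (integral_mono (integrable_of_continuous _ ψ.continuous)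
      (integrable_of_continuous _ ψ'.continuous) h1)

theorem isCompact_lipschitz_Icc {X : Type*} [PseudoMetricSpace X] (C : NNReal) (a b : ℝ) :
    IsCompact {ψ : C(X, ℝ) | (∀ x, ψ x ∈ Set.Icc a b) ∧ LipschitzWith C ψ} := by
  refine ArzelaAscoli.isCompact_of_equicontinuous _ ?_ ?_
  · have e : ContinuousMap.toFun '' {ψ : C(X, ℝ) | (∀ x, ψ x ∈ Set.Icc a b) ∧ LipschitzWith C ψ} =
        Set.pi Set.univ (fun _ : X => Set.Icc a b) ∩
          {f : X → ℝ | ∀ x y, dist (f x) (f y) ≤ C * dist x y} := by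
      ext f
      constructor
      · rintro ⟨ψ, ⟨h1, h2⟩, rfl⟩
        exact ⟨fun x _ => h1 x, fun x y => h2.dist_le_mul x y⟩
      · rintro ⟨h1, h2⟩
        have h3 : LipschitzWith C f := LipschitzWith.of_dist_le_mul h2
        exact ⟨⟨f, h3.continuous⟩, ⟨fun x => h1 x trivial, h3⟩, rfl⟩
    rw [e]
    refine (isCompact_univ_pi fun _ => isCompact_Icc).inter_right ?_
    have e' : {f : X → ℝ | ∀ x y, dist (f x) (f y) ≤ C * dist x y} =
        ⋂ (x : X) (y : X), {f : X → ℝ | dist (f x) (f y) ≤ C * dist x y} := by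
      ext; simp
    rw [e']
    exact isClosed_iInter fun x => isClosed_iInter fun y =>
      isClosed_le ((continuous_apply x).dist (continuous_apply y)) continuous_const
  · exact (LipschitzWith.uniformEquicontinuous _ C fun ψ => ψ.2.2).equicontinuous

theorem exists_minimizer {R : ℝ} (hR : 0 ≤ R) :
    ∃ ψ : C(Sph m, ℝ), (∀ x, ψ x ∈ Set.Icc 0 R) ∧ ∀ ψ' : C(Sph m, ℝ), (∀ x, ψ' x ∈ Set.Icc 0 R) →
      dualEnergy lam mu ψ ≤ dualEnergy lam mu ψ' := by
  obtain ⟨ψ, hψ, hmin⟩ := (isCompact_lipschitz_Icc (X := Sph m) (Real.exp R).toNNReal 0 R).exists_isMinOn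
    ⟨0, fun x => by simpa using hR, (LipschitzWith.const 0).weaken zero_le⟩ (continuous_dualEnergy lam mu).continuousOn
  refine ⟨ψ, hψ.1, fun ψ' hψ' => ?_⟩
  obtain ⟨ψ'', h1, h2, h3⟩ := exists_lipschitz_improvement lam mu hψ'
  exact (hmin ⟨h1, h2⟩).trans h3

end energy

/-! ### The contact map as a transport map -/

/-- Up to a null set, the preimage of a closed set is the projection of a closed set along a compact
factor, hence closed. -/
theorem aemeasurable_of_isClosed_graph {X Y : Type*} [TopologicalSpace X] [MeasurableSpace X]
    [BorelSpace X] [TopologicalSpace Y] [MeasurableSpace Y] [BorelSpace Y] [CompactSpace Y]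
    [MeasurableSpace.CountablyGenerated Y] {nu : Measure X} {C : X → Set Y}
    (hC : IsClosed {p : X × Y | p.2 ∈ C p.1}) {T : X → Y} (hT : ∀ x, T x ∈ C x)
    (huniq : ∀ᵐ x ∂nu, ∀ y ∈ C x, y = T x) : AEMeasurable T nu := by
  refine NullMeasurable.aemeasurable ?_
  refine @measurable_of_isClosed Y (NullMeasurableSpace X nu) _ _ _ _ T fun F hF => ?_
  have h1 : IsClosed (Prod.fst '' ({p : X × Y | p.2 ∈ C p.1} ∩ Prod.snd ⁻¹' F)) :=
    isClosedMap_fst_of_compactSpace _ (hC.inter (hF.preimage continuous_snd))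
  refine NullMeasurableSet.congr h1.measurableSet.nullMeasurableSet ?_
  filter_upwards [huniq] with x hx
  refine propext ⟨?_, fun h => ⟨(x, T x), ⟨hT x, h⟩, rfl⟩⟩
  rintro ⟨⟨x', y⟩, ⟨h2, h3⟩, rfl⟩
  have h4 : y = T x' := hx y h2
  exact h4 ▸ h3

theorem exists_transportMap {m : ℕ} {lam : Measure (Sph m)} (hlam : lam ≪ sphereMeasure m)
    (ψ : C(Sph m, ℝ)) : ∃ T : Sph m → Sph m, AEMeasurable T lam ∧ (∀ n, T n ∈ contactSet ψ n) ∧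
      ∀ᵐ n ∂lam, ∀ x ∈ contactSet ψ n, x = T n := by
  choose T hT using contactSet_nonempty ψ
  let A : Set (Space m) := Set.range fun x : Sph m => Real.exp (ψ x) • (x : Space m)
  have hA : Bornology.IsBounded A := by
    refine (isCompact_range ?_).isBounded
    fun_prop
  have huniq : ∀ᵐ n ∂lam, ∀ x ∈ contactSet ψ n, x = T n := by
    filter_upwards [hlam.ae_le (ae_unique_maximizer hA)] with n hn x hx
    have hmax : ∀ x ∈ contactSet ψ n, ∀ z ∈ A,
        inner ℝ z (n : Space m) ≤ inner ℝ (Real.exp (ψ x) • (x : Space m)) (n : Space m) := by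
      rintro x hx _ ⟨z, rfl⟩
      simp only [inner_smul_left, RCLike.conj_to_real]
      exact (le_supportOf ψ z n).trans_eq (Eq.symm hx)
    have h := hn _ ⟨x, rfl⟩ _ ⟨T n, rfl⟩ (hmax x hx) (hmax _ (hT n))
    -- Comparing norms equates the radii, after which the directions agree.
    have h2 := congrArg norm h
    simp only [norm_smul, Sph.norm_eq, mul_one, Real.norm_eq_abs, Real.abs_exp] at h2
    change Real.exp (ψ x) • (x : Space m) = Real.exp (ψ (T n)) • (T n : Space m) at h
    rw [h2] at h
    exact Subtype.ext (smul_right_injective _ (Real.exp_pos _).ne' h)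
  refine ⟨T, aemeasurable_of_isClosed_graph (C := contactSet ψ) ?_ hT huniq, hT, huniq⟩
  refine isClosed_eq ?_ ((continuous_supportOf ψ).comp continuous_fst)
  fun_prop

/-! ### First variation and one-sided Euler–Lagrange inequalities -/

theorem tendsto_of_tendsto_unique_zero {X : Type*} [TopologicalSpace X] [CompactSpace X]
    {G : X → ℝ} (hG : Continuous G) {x₀ : X} (huniq : ∀ x, G x = 0 → x = x₀) {u : ℕ → X}
    (hu : Tendsto (fun k => G (u k)) atTop (𝓝 0)) : Tendsto u atTop (𝓝 x₀) := by
  refine isCompact_univ.tendsto_nhds_of_unique_mapClusterPt (Eventually.of_forall fun _ => trivial)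
    fun y _ hy => huniq y ?_
  have h1 : MapClusterPt (G y) atTop (G ∘ u) := hy.continuousAt_comp hG.continuousAt
  have h2 : (𝓝 (G y) ⊓ 𝓝 0).NeBot := ClusterPt.mono h1 hu
  exact eq_of_nhds_neBot h2

/-- The first variation of the logarithm of the support function at a regular direction. -/
theorem tendsto_logSupport_variation {m : ℕ} (ψ f : C(Sph m, ℝ)) {n x : Sph m}
    (hx : x ∈ contactSet ψ n) (huniq : ∀ y ∈ contactSet ψ n, y = x) {t : ℕ → ℝ} (ht : ∀ k, 0 < t k)
    (ht0 : Tendsto t atTop (𝓝 0)) :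
    Tendsto (fun k => (logSupport (ψ + t k • f) n - logSupport ψ n) / t k) atTop (𝓝 (f x)) := by
  choose u hu using fun k => contactSet_nonempty (ψ + t k • f) n
  have hf : ∀ y, |f y| ≤ ‖f‖ := f.norm_coe_le_norm
  have hlower : ∀ k, logSupport ψ n + t k * f x ≤ logSupport (ψ + t k • f) n := by
    intro k
    have h1 := le_logSupport (ψ + t k • f) (inner_pos_of_mem_contactSet hx)
    rw [logSupport_eq_of_mem_contactSet hx]
    simp only [ContinuousMap.add_apply, ContinuousMap.smul_apply, smul_eq_mul] at h1
    linarith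
  have hupper : ∀ k, logSupport (ψ + t k • f) n ≤ logSupport ψ n + t k * f (u k) := by
    intro k
    have h1 := le_logSupport ψ (inner_pos_of_mem_contactSet (hu k))
    rw [logSupport_eq_of_mem_contactSet (hu k)]
    simp only [ContinuousMap.add_apply, ContinuousMap.smul_apply, smul_eq_mul]
    linarith
  -- The perturbed contact points are nearly maximal for `ψ` itself, so they converge to its only
  -- contact point.
  have hux : Tendsto u atTop (𝓝 x) := by
    refine tendsto_of_tendsto_unique_zero
      (G := fun y => supportOf ψ n - Real.exp (ψ y) * inner ℝ (y : Space m) (n : Space m))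
      (by fun_prop) (fun y hy => huniq y (sub_eq_zero.1 hy).symm) ?_
    refine squeeze_zero (fun k => sub_nonneg.2 (le_supportOf ψ _ n))
      (g := fun k => supportOf ψ n * (1 - Real.exp (-(2 * t k * ‖f‖)))) (fun k => ?_) ?_
    · have h1 := logSupport_eq_of_mem_contactSet (hu k)
      simp only [ContinuousMap.add_apply, ContinuousMap.smul_apply, smul_eq_mul] at h1
      have hi := inner_pos_of_mem_contactSet (hu k)
      have h2 : logSupport ψ n - 2 * t k * ‖f‖ ≤
          ψ (u k) + Real.log (inner ℝ (u k : Space m) (n : Space m)) := by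
        have h3 := hlower k
        have h4 := mul_le_mul_of_nonneg_left (abs_le.1 (hf x)).1 (ht k).le
        have h5 := mul_le_mul_of_nonneg_left (abs_le.1 (hf (u k))).2 (ht k).le
        linarith
      have h6 := Real.exp_le_exp.2 h2
      rw [Real.exp_add, Real.exp_log hi, sub_eq_add_neg, Real.exp_add, logSupport,
        Real.exp_log (supportOf_pos ψ n)] at h6
      linarith
    · have h1 : Tendsto (fun k => supportOf ψ n * (1 - Real.exp (-(2 * t k * ‖f‖)))) atTop
          (𝓝 (supportOf ψ n * (1 - Real.exp (-(2 * 0 * ‖f‖))))) := by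
        refine Tendsto.const_mul _ (Tendsto.const_sub _ ?_)
        exact (Real.continuous_exp.tendsto _).comp (((ht0.const_mul 2).mul_const _).neg)
      simpa using h1
  refine tendsto_of_tendsto_of_tendsto_of_le_of_le tendsto_const_nhds
    ((f.continuous.tendsto x).comp hux) (fun k => ?_) (fun k => ?_)
  · change f x ≤ _
    rw [le_div_iff₀ (ht k)]
    linarith [hlower k]
  · change _ ≤ f (u k)
    rw [div_le_iff₀ (ht k)]
    linarith [hupper k]

section EulerLagrange

variable {m : ℕ} {lam mu : Measure (Sph m)} [IsProbabilityMeasure lam] [IsProbabilityMeasure mu]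
  {R : ℝ} {ψ : C(Sph m, ℝ)} {T : Sph m → Sph m}

/-- One-sided derivative of the energy along an admissible direction `f`, with dominated convergence
by `‖f‖`. -/
theorem integral_le_of_minimizer
    (hmin : ∀ ψ' : C(Sph m, ℝ), (∀ x, ψ' x ∈ Set.Icc 0 R) →
      dualEnergy lam mu ψ ≤ dualEnergy lam mu ψ')
    (hTm : AEMeasurable T lam) (hT : ∀ n, T n ∈ contactSet ψ n)
    (huniq : ∀ᵐ n ∂lam, ∀ x ∈ contactSet ψ n, x = T n) (f : C(Sph m, ℝ)) {t₀ : ℝ} (ht₀ : 0 < t₀)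
    (hf : ∀ t, 0 < t → t ≤ t₀ → ∀ x, ψ x + t * f x ∈ Set.Icc 0 R) :
    ∫ x, f x ∂mu ≤ ∫ x, f x ∂(lam.map T) := by
  rw [integral_map hTm f.continuous.aestronglyMeasurable]
  let t : ℕ → ℝ := fun k => t₀ * (1 / ((k : ℝ) + 1))
  have ht : ∀ k, 0 < t k := fun k => mul_pos ht₀ Nat.one_div_pos_of_nat
  have ht1 : ∀ k, t k ≤ t₀ := fun k => by
    refine mul_le_of_le_one_right ht₀.le ?_
    have := Nat.one_div_le_one_div (α := ℝ) (Nat.zero_le k)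
    simpa using this
  have htlim : Tendsto t atTop (𝓝 0) := by
    simpa only [mul_zero] using tendsto_one_div_add_atTop_nhds_zero_nat.const_mul t₀
  have hlim : Tendsto (fun k => ∫ n, (logSupport (ψ + t k • f) n - logSupport ψ n) / t k ∂lam) atTop
      (𝓝 (∫ n, f (T n) ∂lam)) := by
    refine tendsto_integral_of_dominated_convergence (fun _ => ‖f‖)
      (fun k => (((continuous_logSupport _).sub
        (continuous_logSupport _)).div_const _).aestronglyMeasurable)
      (integrable_const _) (fun k => Eventually.of_forall fun n => ?_) ?_
    · have hb : ∀ y, |f y| ≤ ‖f‖ := f.norm_coe_le_norm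
      have h1 : logSupport (ψ + t k • f) n ≤ logSupport ψ n + t k * ‖f‖ := by
        refine logSupport_le_add (fun x => ?_) n
        have := mul_le_mul_of_nonneg_left (abs_le.1 (hb x)).2 (ht k).le
        simp only [ContinuousMap.add_apply, ContinuousMap.smul_apply, smul_eq_mul]
        linarith
      have h2 : logSupport ψ n ≤ logSupport (ψ + t k • f) n + t k * ‖f‖ := by
        refine logSupport_le_add (fun x => ?_) n
        have := mul_le_mul_of_nonneg_left (abs_le.1 (hb x)).1 (ht k).le
        simp only [ContinuousMap.add_apply, ContinuousMap.smul_apply, smul_eq_mul]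
        linarith
      rw [Real.norm_eq_abs, abs_div, abs_of_pos (ht k), div_le_iff₀ (ht k), abs_le]
      constructor <;> linarith
    · filter_upwards [huniq] with n hn
      exact tendsto_logSupport_variation ψ f (hT n) hn ht htlim
  refine ge_of_tendsto' hlim fun k => ?_
  have h1 := hmin (ψ + t k • f) fun x => by
    simpa using hf (t k) (ht k) (ht1 k) x
  have hi := integrable_of_continuous mu f.continuous
  have e : ∫ x, (ψ + t k • f) x ∂mu = ∫ x, ψ x ∂mu + t k * ∫ x, f x ∂mu := by
    simp only [ContinuousMap.add_apply, ContinuousMap.smul_apply, smul_eq_mul]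
    rw [integral_add (integrable_of_continuous mu ψ.continuous) (hi.const_mul _),
      integral_const_mul]
  rw [integral_div, integral_sub (integrable_of_continuous _ (continuous_logSupport _))
    (integrable_of_continuous _ (continuous_logSupport _)), le_div_iff₀ (ht k)]
  rw [dualEnergy, dualEnergy, e] at h1
  linarith

end EulerLagrange

/-- By inner regularity a closed `F ⊆ B` suffices. There `w` is bounded below, so an approximate
indicator of `F` can be divided by `w`, truncated from below at its minimum on `F`. -/
theorem measure_le_of_forall_integral_mul_le {m : ℕ} {mu nu : Measure (Sph m)} [IsFiniteMeasure mu]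
    [IsFiniteMeasure nu] {w : C(Sph m, ℝ)} (hw : ∀ x, 0 ≤ w x)
    (h : ∀ g : C(Sph m, ℝ), (∀ x, 0 ≤ g x) → ∫ x, g x * w x ∂mu ≤ ∫ x, g x * w x ∂nu)
    {B : Set (Sph m)} (hB : MeasurableSet B) (hBw : ∀ x ∈ B, 0 < w x) : mu B ≤ nu B := by
  rw [hB.measure_eq_iSup_isClosed_of_ne_top (measure_ne_top mu B)]
  refine iSup_le fun F => iSup_le fun hFB => iSup_le fun hF => le_trans ?_ (measure_mono hFB)
  rcases F.eq_empty_or_nonempty with rfl | hne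
  · simp
  obtain ⟨x₀, hx₀, hmin⟩ := hF.isCompact.exists_isMinOn hne w.continuous.continuousOn
  have hc : 0 < w x₀ := hBw _ (hFB hx₀)
  have hpos : ∀ x, 0 < max (w x) (w x₀) := fun x => lt_max_of_lt_right hc
  refine ge_of_tendsto' (tendsto_lintegral_thickenedIndicator_of_isClosed nu hF
    (δs := fun k : ℕ => 1 / ((k : ℝ) + 1)) (fun k => Nat.one_div_pos_of_nat)
    tendsto_one_div_add_atTop_nhds_zero_nat) fun k => ?_
  set θ := thickenedIndicator (δ := 1 / ((k : ℝ) + 1)) Nat.one_div_pos_of_nat F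
  have hθ : Continuous fun x => (θ x : ℝ) := by
    exact NNReal.continuous_coe.comp θ.continuous
  let g : C(Sph m, ℝ) := ⟨fun x => (θ x : ℝ) / max (w x) (w x₀),
    hθ.div (by fun_prop) fun x => (hpos x).ne'⟩
  have hg : ∀ x, 0 ≤ g x := fun x => div_nonneg (θ x).2 (hpos x).le
  have hgθ : ∀ x, g x * w x ≤ θ x := by
    intro x
    calc g x * w x ≤ g x * max (w x) (w x₀) := mul_le_mul_of_nonneg_left (le_max_left _ _) (hg x)
      _ = θ x := div_mul_cancel₀ _ (hpos x).ne'
  have hgF : ∀ x ∈ F, g x * w x = 1 := by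
    intro x hx
    have h1 : w x₀ ≤ w x := hmin hx
    change (θ x : ℝ) / max (w x) (w x₀) * w x = 1
    rw [thickenedIndicator_one _ F hx, max_eq_left h1]
    simp [(hc.trans_le h1).ne']
  have hgc : Continuous fun x => g x * w x := by fun_prop
  have h1 : mu.real F ≤ ∫ x, g x * w x ∂mu := by
    rw [← integral_indicator_one hF.measurableSet]
    refine integral_mono ((integrable_const 1).indicator hF.measurableSet)
      (integrable_of_continuous _ hgc) fun x => ?_
    by_cases hx : x ∈ F
    · rw [Set.indicator_of_mem hx, hgF x hx, Pi.one_apply]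
    · rw [Set.indicator_of_notMem hx]; exact mul_nonneg (hg x) (hw x)
  have h2 : ∫ x, g x * w x ∂nu ≤ ∫ x, (θ x : ℝ) ∂nu :=
    integral_mono (integrable_of_continuous _ hgc) (integrable_of_continuous _ hθ) hgθ
  calc mu F = ENNReal.ofReal (mu.real F) := (ofReal_measureReal).symm
    _ ≤ ENNReal.ofReal (∫ x, (θ x : ℝ) ∂nu) := ENNReal.ofReal_le_ofReal (h1.trans ((h g hg).trans h2))
    _ = ∫⁻ x, (θ x : ENNReal) ∂nu := by
      rw [ofReal_integral_eq_lintegral_ofReal (integrable_of_continuous _ hθ)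
        (Eventually.of_forall fun x => (θ x).2)]
      simp only [ENNReal.ofReal_coe_nnreal]

section EulerLagrange

variable {m : ℕ} {lam mu : Measure (Sph m)} [IsProbabilityMeasure lam] [IsProbabilityMeasure mu]
  {R : ℝ} {ψ : C(Sph m, ℝ)} {T : Sph m → Sph m}

theorem le_map_of_minimizer (hψ : ∀ x, ψ x ∈ Set.Icc 0 R)
    (hmin : ∀ ψ' : C(Sph m, ℝ), (∀ x, ψ' x ∈ Set.Icc 0 R) →
      dualEnergy lam mu ψ ≤ dualEnergy lam mu ψ')
    (hTm : AEMeasurable T lam) (hT : ∀ n, T n ∈ contactSet ψ n)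
    (huniq : ∀ᵐ n ∂lam, ∀ x ∈ contactSet ψ n, x = T n) {B : Set (Sph m)} (hB : MeasurableSet B)
    (hBR : ∀ x ∈ B, ψ x < R) : mu B ≤ lam.map T B := by
  refine measure_le_of_forall_integral_mul_le (w := ContinuousMap.const _ R - ψ)
    (fun x => sub_nonneg.2 (hψ x).2) (fun g hg => ?_) hB fun x hx => sub_pos.2 (hBR x hx)
  -- This direction vanishes where the upper constraint is active. The choice of `t₀` gives `t * g ≤
  -- 1`, so the perturbation is a convex combination of `ψ` and `R`.
  refine integral_le_of_minimizer hmin hTm hT huniq (g * (ContinuousMap.const _ R - ψ))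
    (t₀ := 1 / (‖g‖ + 1)) (by positivity) fun t ht htg x => ?_
  have h1 : t * g x ≤ 1 := by
    have h2 : g x ≤ ‖g‖ + 1 := by linarith [(abs_le.1 (g.norm_coe_le_norm x)).2]
    calc t * g x ≤ 1 / (‖g‖ + 1) * (‖g‖ + 1) :=
          mul_le_mul htg h2 (hg x) (by positivity)
      _ = 1 := one_div_mul_cancel (by positivity)
  have h3 : 0 ≤ t * g x := mul_nonneg ht.le (hg x)
  have h4 := hψ x
  simp only [ContinuousMap.mul_apply, ContinuousMap.sub_apply, ContinuousMap.const_apply]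
  constructor <;> nlinarith [h4.1, h4.2]

theorem map_le_of_minimizer (hψ : ∀ x, ψ x ∈ Set.Icc 0 R)
    (hmin : ∀ ψ' : C(Sph m, ℝ), (∀ x, ψ' x ∈ Set.Icc 0 R) →
      dualEnergy lam mu ψ ≤ dualEnergy lam mu ψ')
    (hTm : AEMeasurable T lam) (hT : ∀ n, T n ∈ contactSet ψ n)
    (huniq : ∀ᵐ n ∂lam, ∀ x ∈ contactSet ψ n, x = T n) {B : Set (Sph m)} (hB : MeasurableSet B)
    (hB0 : ∀ x ∈ B, 0 < ψ x) : lam.map T B ≤ mu B := by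
  have := Measure.isProbabilityMeasure_map hTm
  refine measure_le_of_forall_integral_mul_le (w := ψ)
    (fun x => (hψ x).1) (fun g hg => ?_) hB hB0
  -- The downward analogue: a convex combination of `ψ` and `0`.
  have h := integral_le_of_minimizer hmin hTm hT huniq (-(g * ψ))
    (t₀ := 1 / (‖g‖ + 1)) (by positivity) fun t ht htg x => ?_
  · simpa [integral_neg] using h
  have h1 : t * g x ≤ 1 := by
    have h2 : g x ≤ ‖g‖ + 1 := by linarith [(abs_le.1 (g.norm_coe_le_norm x)).2]
    calc t * g x ≤ 1 / (‖g‖ + 1) * (‖g‖ + 1) :=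
          mul_le_mul htg h2 (hg x) (by positivity)
      _ = 1 := one_div_mul_cancel (by positivity)
  have h3 : 0 ≤ t * g x := mul_nonneg ht.le (hg x)
  have h4 := hψ x
  simp only [ContinuousMap.neg_apply, ContinuousMap.mul_apply]
  constructor <;> nlinarith [h4.1, h4.2]

end EulerLagrange

/-! ### Mass balance and solution of the transport problem -/

/-- Total masses agree on `A` and on its complement, so a one-sided inequality for all subsets of
either leaves no room for strictness. -/
theorem eq_of_le_of_le_compl {X : Type*} [MeasurableSpace X] {mu nu : Measure X}
    [IsProbabilityMeasure mu] [IsProbabilityMeasure nu] {A : Set X} (hA : MeasurableSet A)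
    (h : mu A = nu A) (h1 : ∀ B, MeasurableSet B → B ⊆ A → nu B ≤ mu B)
    (h2 : ∀ B, MeasurableSet B → B ⊆ Aᶜ → mu B ≤ nu B) : mu = nu := by
  have key : ∀ (p q : Measure X) [IsProbabilityMeasure p] [IsProbabilityMeasure q] (S : Set X),
      MeasurableSet S → p S = q S → (∀ B, MeasurableSet B → B ⊆ S → p B ≤ q B) →
      ∀ B, MeasurableSet B → p (B ∩ S) = q (B ∩ S) := by
    intro p q _ _ S hS hpq hle B hB
    refine le_antisymm (hle _ (hB.inter hS) Set.inter_subset_right) ?_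
    have e1 := measure_inter_add_sdiff (μ := p) S hB
    have e2 := measure_inter_add_sdiff (μ := q) S hB
    have h3 := hle _ (hS.diff hB) Set.sdiff_subset
    rw [Set.inter_comm B S]
    refine ENNReal.le_of_add_le_add_right (measure_ne_top p (S \ B)) ?_
    rw [e1, hpq, ← e2]
    exact add_le_add_right h3 _
  ext B hB
  rw [← measure_inter_add_sdiff B hA, ← measure_inter_add_sdiff (μ := nu) B hA,
    Set.sdiff_eq, key nu mu A hA h.symm h1 B hB, key mu nu Aᶜ hA.compl ?_ h2 B hB]
  rw [prob_compl_eq_one_sub hA, prob_compl_eq_one_sub hA, h]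

/-- A decreasing sequence of subsets of a finite set becomes stationary quickly. -/
theorem exists_eq_succ_of_antitone {ι : Type*} [DecidableEq ι] (P : Finset ι) (I : ℕ → Finset ι)
    (hI : ∀ k, I (k + 1) ⊆ I k) (h0 : I 0 ⊆ P) : ∃ k ≤ P.card, I (k + 1) = I k := by
  by_contra! hne
  have key : ∀ k ≤ P.card + 1, (I k).card + k ≤ P.card := by
    intro k
    induction k with
    | zero => intro _; simpa using Finset.card_le_card h0
    | succ k ih =>
      intro hk
      have h1 := ih (by omega)
      have h2 := Finset.card_lt_card ((hI k).ssubset_of_ne (hne k (by omega)))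
      omega
  have := key (P.card + 1) le_rfl
  omega

/-- The mass balance forces the constrained minimizer to be a solution once the range of the
potentials is large enough. -/
theorem exists_potential {m : ℕ} {lam mu : Measure (Sph m)} [IsProbabilityMeasure lam]
    [IsProbabilityMeasure mu] (hlam : lam ≪ sphereMeasure m) {d : ℝ} (hd : 0 < d)
    (hF : ∀ F : Set (Sph m), IsClosed F →
      mu F ≤ lam {n | ∃ x ∈ F, d < inner ℝ (n : Space m) (x : Space m)}) :
    ∃ (ψ : C(Sph m, ℝ)) (T : Sph m → Sph m), AEMeasurable T lam ∧ (∀ n, T n ∈ contactSet ψ n) ∧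
      mu = lam.map T := by
  classical
  obtain ⟨P, -, hPfin, hP⟩ := (isCompact_univ (X := Sph m)).finite_cover_balls
    (e := d / 4) (by positivity)
  lift P to Finset (Sph m) using hPfin
  obtain ⟨D, hD0, hD⟩ : ∃ D > 0, -D ≤ Real.log (d / 2) :=
    ⟨|Real.log (d / 2)| + 1, by positivity, by linarith [neg_abs_le (Real.log (d / 2))]⟩
  -- Large enough to contain every level `D * (k + 1)` with `k ≤ P.card`.
  set R : ℝ := D * (P.card + 2) with hR
  have hR0 : 0 ≤ R := by positivity
  obtain ⟨ψ, hψ, hmin⟩ := exists_minimizer lam mu hR0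
  obtain ⟨T, hTm, hT, huniq⟩ := exists_transportMap hlam ψ
  refine ⟨ψ, T, hTm, hT, ?_⟩
  have := Measure.isProbabilityMeasure_map hTm
  let A : ℝ → Set (Sph m) := fun t => {x | t ≤ ψ x}
  have hA : ∀ t, IsClosed (A t) := fun t => isClosed_le continuous_const ψ.continuous
  let I : ℝ → Finset (Sph m) := fun t =>
    P.filter fun p => (A t ∩ Metric.closedBall p (d / 4)).Nonempty
  let E : ℝ → Set (Sph m) := fun t => ⋃ p ∈ I t, Metric.closedBall p (d / 4)
  have hE : ∀ t, IsClosed (E t) := fun t =>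
    (I t).finite_toSet.isClosed_biUnion fun p _ => Metric.isClosed_closedBall
  have hAE : ∀ t, A t ⊆ E t := by
    intro t x hx
    obtain ⟨p, hp, hxp⟩ := Set.mem_iUnion₂.1 (hP (Set.mem_univ x))
    have hxp' := Metric.ball_subset_closedBall hxp
    exact Set.mem_iUnion₂.2 ⟨p, Finset.mem_filter.2 ⟨hp, x, hx, hxp'⟩, hxp'⟩
  -- A normal `n` in the enlargement of `E t` has inner product at least `d / 2` with some `y` in `A
  -- t`. Hence `logSupport ψ n ≥ t - D`, and `ψ (T n)` is no smaller.
  have hEmu : ∀ t, mu (E t) ≤ lam.map T (A (t - D)) := by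
    intro t
    rw [Measure.map_apply_of_aemeasurable hTm (hA _).measurableSet]
    refine (hF _ (hE t)).trans (measure_mono ?_)
    rintro n ⟨x, hx, hnx⟩
    obtain ⟨p, hp, hxp⟩ := Set.mem_iUnion₂.1 hx
    obtain ⟨-, y, hy, hyp⟩ := Finset.mem_filter.1 hp
    have hxy : dist x y ≤ d / 2 := by
      have h1 := dist_triangle_right x y p
      rw [Metric.mem_closedBall] at hxp hyp
      linarith
    have h2 := (abs_le.1 (Sph.abs_inner_sub_inner_le x y n)).2
    rw [real_inner_comm] at hnx
    have h3 : d / 2 ≤ inner ℝ (y : Space m) (n : Space m) := by linarith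
    have h4 := le_logSupport ψ ((half_pos hd).trans_le h3)
    have h5 := Real.log_le_log (half_pos hd) h3
    have h6 := logSupport_eq_of_mem_contactSet (hT n)
    have h7 := Real.log_nonpos (inner_pos_of_mem_contactSet (hT n)).le (Sph.inner_le_one _ _)
    have h8 : t ≤ ψ y := hy
    change t - D ≤ ψ (T n)
    linarith
  -- The shift `k + 1` keeps the chosen level positive, as the inequality on `{0 < ψ}` requires.
  obtain ⟨k, hk, hIk⟩ := exists_eq_succ_of_antitone P (fun k => I (D * (k + 1))) (by
    intro k p hp
    obtain ⟨h1, y, hy, hyp⟩ := Finset.mem_filter.1 hp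
    have hy' : D * (((k + 1 : ℕ) : ℝ) + 1) ≤ ψ y := hy
    refine Finset.mem_filter.2 ⟨h1, y, ?_, hyp⟩
    change D * (k + 1) ≤ ψ y
    push_cast at hy'
    linarith) (Finset.filter_subset _ _)
  set s : ℝ := D * (k + 1) with hs
  have hs0 : 0 < s := by positivity
  have hsR : s ≤ R := by
    have : (k : ℝ) ≤ P.card := by exact_mod_cast hk
    rw [hs, hR]
    nlinarith
  have hEs : E (s + D) = E s := by
    have e : s + D = D * (((k + 1 : ℕ) : ℝ) + 1) := by push_cast; ring
    simp only [E]
    rw [e, hIk]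
  -- Stationarity of the covers absorbs the loss of `D` in `hEmu`.
  have h1 : mu (A s) ≤ lam.map T (A s) := by
    have := hEmu (s + D)
    rw [add_sub_cancel_right, hEs] at this
    exact (measure_mono (hAE s)).trans this
  have h2 : ∀ B, MeasurableSet B → B ⊆ A s → lam.map T B ≤ mu B := fun B hB hBs =>
    map_le_of_minimizer hψ hmin hTm hT huniq hB fun x hx => hs0.trans_le (hBs hx)
  refine eq_of_le_of_le_compl (hA s).measurableSet
    (le_antisymm h1 (h2 _ (hA s).measurableSet subset_rfl)) h2 fun B hB hBs =>
    le_map_of_minimizer hψ hmin hTm hT huniq hB fun x hx => ?_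
  have : ¬ s ≤ ψ x := hBs hx
  linarith

/-! ### Convex bodies, radial functions and Gauss images -/

section bodies

variable {m : ℕ} {K : ConvexBody (Space m)}

theorem gauge_pos_of_zero_mem_interior (hK : (0 : Space m) ∈ interior (K : Set (Space m)))
    (x : Sph m) : 0 < gauge (K : Set (Space m)) (x : Space m) :=
  (gauge_pos (absorbent_nhds_zero (mem_interior_iff_mem_nhds.1 hK))
    (NormedSpace.isVonNBounded_of_isBounded ℝ K.isBounded)).2 (ne_zero_of_mem_unit_sphere x)

theorem smul_mem_iff_le_inv_gauge (hK : (0 : Space m) ∈ interior (K : Set (Space m)))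
    (x : Sph m) {r : ℝ} (hr : 0 ≤ r) :
    r • (x : Space m) ∈ K ↔ r ≤ (gauge (K : Set (Space m)) (x : Space m))⁻¹ := by
  have h := gauge_le_one_iff_mem_closure (x := r • (x : Space m)) K.convex
    (mem_interior_iff_mem_nhds.1 hK)
  rw [K.isClosed.closure_eq, gauge_smul_of_nonneg hr, smul_eq_mul] at h
  rw [← SetLike.mem_coe, ← h, ← one_div, le_div_iff₀ (gauge_pos_of_zero_mem_interior hK x)]

theorem radialFunction_eq_inv_gauge (hK : (0 : Space m) ∈ interior (K : Set (Space m)))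
    (x : Sph m) : radialFunction K x = (gauge (K : Set (Space m)) (x : Space m))⁻¹ := by
  have e : {r : ℝ | 0 ≤ r ∧ r • (x : Space m) ∈ K} =
      Set.Icc 0 (gauge (K : Set (Space m)) (x : Space m))⁻¹ := by
    ext r
    exact and_congr_right fun hr => smul_mem_iff_le_inv_gauge hK x hr
  rw [radialFunction, e, csSup_Icc (inv_nonneg.2 (gauge_nonneg _))]

theorem radialFunction_pos (hK : (0 : Space m) ∈ interior (K : Set (Space m))) (x : Sph m) :
    0 < radialFunction K x := by
  rw [radialFunction_eq_inv_gauge hK]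
  exact inv_pos.2 (gauge_pos_of_zero_mem_interior hK x)

theorem smul_mem_iff_le_radialFunction (hK : (0 : Space m) ∈ interior (K : Set (Space m)))
    (x : Sph m) {r : ℝ} (hr : 0 ≤ r) : r • (x : Space m) ∈ K ↔ r ≤ radialFunction K x := by
  rw [smul_mem_iff_le_inv_gauge hK x hr, radialFunction_eq_inv_gauge hK]

theorem radialMap_mem (hK : (0 : Space m) ∈ interior (K : Set (Space m))) (x : Sph m) :
    radialMap K x ∈ K :=
  (smul_mem_iff_le_radialFunction hK x (radialFunction_pos hK x).le).2 le_rfl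

theorem continuous_radialFunction (hK : (0 : Space m) ∈ interior (K : Set (Space m))) :
    Continuous (radialFunction K) := by
  rw [funext (radialFunction_eq_inv_gauge hK)]
  exact ((continuous_gauge K.convex (mem_interior_iff_mem_nhds.1 hK)).comp
    continuous_subtype_val).inv₀ fun x => (gauge_pos_of_zero_mem_interior hK x).ne'

/-- The logarithm of the radial function. -/
noncomputable def logRadial (hK : (0 : Space m) ∈ interior (K : Set (Space m))) : C(Sph m, ℝ) :=
  ⟨fun x => Real.log (radialFunction K x),
    (continuous_radialFunction hK).log fun x => (radialFunction_pos hK x).ne'⟩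

theorem exp_logRadial (hK : (0 : Space m) ∈ interior (K : Set (Space m))) (x : Sph m) :
    Real.exp (logRadial hK x) = radialFunction K x :=
  Real.exp_log (radialFunction_pos hK x)

theorem inner_radialMap (x n : Sph m) : inner ℝ (radialMap K x) (n : Space m) =
    radialFunction K x * inner ℝ (x : Space m) (n : Space m) := by
  rw [radialMap, inner_smul_left, RCLike.conj_to_real]

/-- `K` is the union of the segments from the origin to its radial points, so those points alone
determine its (positive) support function. -/
theorem mem_gaussMap_radialMap_iff (hK : (0 : Space m) ∈ interior (K : Set (Space m)))
    {x n : Sph m} : n ∈ gaussMap K (radialMap K x) ↔ x ∈ contactSet (logRadial hK) n := by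
  constructor
  · intro h
    refine le_antisymm (le_supportOf _ x n) (ciSup_le fun y => ?_)
    have h1 := h _ (radialMap_mem hK y)
    rw [inner_sub_left, inner_radialMap, inner_radialMap] at h1
    rw [exp_logRadial, exp_logRadial]
    linarith
  · intro h y hy
    have h1 : Real.exp (logRadial hK x) * inner ℝ (x : Space m) (n : Space m) =
      supportOf (logRadial hK) n := h
    rw [exp_logRadial] at h1
    rw [inner_sub_left, inner_radialMap, h1, sub_nonpos]
    by_cases hy0 : y = 0
    · rw [hy0, inner_zero_left]
      exact (supportOf_pos _ n).le
    have hn : ‖y‖ ≠ 0 := norm_ne_zero_iff.2 hy0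
    let z : Sph m := ⟨‖y‖⁻¹ • y, by simp [norm_smul, hn]⟩
    have hz : y = ‖y‖ • (z : Space m) := by
      change y = ‖y‖ • ‖y‖⁻¹ • y
      rw [smul_inv_smul₀ hn]
    have h2 : ‖y‖ ≤ radialFunction K z := by
      rw [← smul_mem_iff_le_radialFunction hK z (norm_nonneg y), ← hz]
      exact hy
    rw [hz, inner_smul_left, RCLike.conj_to_real]
    rcases le_total (inner ℝ (z : Space m) (n : Space m)) 0 with h3 | h3
    · exact (mul_nonpos_of_nonneg_of_nonpos (norm_nonneg y) h3).trans (supportOf_pos _ n).le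
    · refine (mul_le_mul_of_nonneg_right h2 h3).trans ?_
      rw [← exp_logRadial hK]
      exact le_supportOf _ z n

theorem gaussImage_ae_eq {lam : Measure (Sph m)}
    (hK : (0 : Space m) ∈ interior (K : Set (Space m))) {T : Sph m → Sph m}
    (hT : ∀ n, T n ∈ contactSet (logRadial hK) n)
    (huniq : ∀ᵐ n ∂lam, ∀ x ∈ contactSet (logRadial hK) n, x = T n) (ω : Set (Sph m)) :
    gaussImage K ω =ᵐ[lam] T ⁻¹' ω := by
  filter_upwards [huniq] with n hn
  refine propext ⟨fun h => ?_, fun h => ?_⟩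
  · obtain ⟨x, hx, hnx⟩ := Set.mem_iUnion₂.1 h
    have e : x = T n := hn x ((mem_gaussMap_radialMap_iff hK).1 hnx)
    change T n ∈ ω
    rwa [← e]
  · exact Set.mem_iUnion₂.2 ⟨T n, h, (mem_gaussMap_radialMap_iff hK).2 (hT n)⟩

/-- `K` is the intersection of the half-spaces given by `supportOf ψ`. Its radial function may
exceed `exp ψ`, but contact pairs of `ψ` still lie on supporting hyperplanes. -/
theorem exists_convexBody_contactSet_subset (ψ : C(Sph m, ℝ)) :
    ∃ (K : ConvexBody (Space m)) (hK : (0 : Space m) ∈ interior (K : Set (Space m))),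
      ∀ n, contactSet ψ n ⊆ contactSet (logRadial hK) n := by
  obtain ⟨n₀, -, hmin⟩ := isCompact_univ.exists_isMinOn Set.univ_nonempty
    (continuous_supportOf ψ).continuousOn
  obtain ⟨n₁, -, hmax⟩ := isCompact_univ.exists_isMaxOn Set.univ_nonempty
    (continuous_supportOf ψ).continuousOn
  let S : Set (Space m) := {y | ∀ n : Sph m, inner ℝ y (n : Space m) ≤ supportOf ψ n}
  have hS : S = ⋂ n : Sph m, {y : Space m | inner ℝ y (n : Space m) ≤ supportOf ψ n} := by
    ext; simp [S]
  have hconv : Convex ℝ S := by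
    rw [hS]
    refine convex_iInter fun n => convex_halfSpace_le ⟨fun x y => ?_, fun c x => ?_⟩ _
    · exact inner_add_left _ _ _
    · rw [inner_smul_left, RCLike.conj_to_real, smul_eq_mul]
  have hclosed : IsClosed S := by
    rw [hS]
    exact isClosed_iInter fun n => isClosed_le (by fun_prop) continuous_const
  have hbdd : S ⊆ Metric.closedBall 0 (supportOf ψ n₁) := by
    intro y hy
    rw [mem_closedBall_zero_iff]
    by_cases hy0 : y = 0
    · rw [hy0, norm_zero]
      exact (supportOf_pos _ _).le
    have hn : ‖y‖ ≠ 0 := norm_ne_zero_iff.2 hy0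
    have h1 := hy ⟨‖y‖⁻¹ • y, by simp [norm_smul, hn]⟩
    rw [inner_smul_right, real_inner_self_eq_norm_sq, sq, inv_mul_cancel_left₀ hn] at h1
    exact h1.trans (hmax (Set.mem_univ _))
  have hball : Metric.ball 0 (supportOf ψ n₀) ⊆ S := by
    intro y hy n
    rw [mem_ball_zero_iff] at hy
    have h1 : inner ℝ y (n : Space m) ≤ ‖y‖ := by
      simpa [Sph.norm_eq] using real_inner_le_norm y (n : Space m)
    exact h1.trans (hy.le.trans (hmin (Set.mem_univ n)))
  have h0 : (0 : Space m) ∈ interior S :=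
    mem_interior.2 ⟨_, hball, Metric.isOpen_ball, Metric.mem_ball_self (supportOf_pos _ _)⟩
  let K : ConvexBody (Space m) :=
    ⟨S, hconv, Metric.isCompact_of_isClosed_isBounded hclosed
      (Metric.isBounded_closedBall.subset hbdd), ⟨0, interior_subset h0⟩⟩
  have hK : (0 : Space m) ∈ interior (K : Set (Space m)) := h0
  refine ⟨K, hK, fun n x hx => (mem_gaussMap_radialMap_iff hK).1 fun y hy => ?_⟩
  have h1 : Real.exp (ψ x) * inner ℝ (x : Space m) (n : Space m) = supportOf ψ n := hx
  have h2 : Real.exp (ψ x) • (x : Space m) ∈ K := by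
    intro n'
    rw [inner_smul_left, RCLike.conj_to_real]
    exact le_supportOf ψ x n'
  have h3 := (smul_mem_iff_le_radialFunction hK x (Real.exp_pos _).le).1 h2
  have h4 : inner ℝ y (n : Space m) ≤ supportOf ψ n := hy n
  rw [inner_sub_left, inner_radialMap, sub_nonpos]
  refine h4.trans (h1.symm.le.trans ?_)
  exact mul_le_mul_of_nonneg_right h3 (inner_pos_of_mem_contactSet hx).le

end bodies

/-! ### Uniqueness of the contact map -/

section uniqueness

variable {m : ℕ} {lam : Measure (Sph m)} [IsProbabilityMeasure lam] {ψ ψ' : C(Sph m, ℝ)}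
  {T T' : Sph m → Sph m}

theorem logSupport_sub_le {n : Sph m} (hT' : T' n ∈ contactSet ψ' n) :
    logSupport ψ' n - ψ' (T' n) ≤ logSupport ψ n - ψ (T' n) := by
  linarith [logSupport_eq_of_mem_contactSet hT', le_logSupport ψ (inner_pos_of_mem_contactSet hT')]

theorem integrable_logSupport_sub (hTm : AEMeasurable T lam) (ψ : C(Sph m, ℝ)) :
    Integrable (fun n => logSupport ψ n - ψ (T n)) lam := by
  have := Measure.isProbabilityMeasure_map hTm
  exact (integrable_of_continuous _ (continuous_logSupport ψ)).sub
    ((integrable_of_continuous (lam.map T) ψ.continuous).comp_aemeasurable hTm)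

theorem integral_logSupport_sub (hTm : AEMeasurable T lam) (ψ : C(Sph m, ℝ)) :
    ∫ n, (logSupport ψ n - ψ (T n)) ∂lam = dualEnergy lam (lam.map T) ψ := by
  have := Measure.isProbabilityMeasure_map hTm
  rw [dualEnergy, integral_map hTm ψ.continuous.aestronglyMeasurable]
  exact integral_sub (integrable_of_continuous _ (continuous_logSupport ψ))
    ((integrable_of_continuous (lam.map T) ψ.continuous).comp_aemeasurable hTm)

/-- Along the graph of `T'`, the integrand `logSupport ψ n - ψ (T' n)` is at least `-log ⟪T' n, n⟫`,
with equality for `ψ'`. -/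
theorem dualEnergy_le_of_contact (hTm' : AEMeasurable T' lam)
    (hT' : ∀ n, T' n ∈ contactSet ψ' n) :
    dualEnergy lam (lam.map T') ψ' ≤ dualEnergy lam (lam.map T') ψ := by
  rw [← integral_logSupport_sub hTm', ← integral_logSupport_sub hTm']
  exact integral_mono (integrable_logSupport_sub hTm' _) (integrable_logSupport_sub hTm' _)
    fun n => logSupport_sub_le (hT' n)

/-- Two potentials whose contact maps transport `lam` to the same measure have the same optimal
pairs. -/
theorem ae_mem_contactSet_of_map_eq (hTm : AEMeasurable T lam) (hTm' : AEMeasurable T' lam)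
    (hT : ∀ n, T n ∈ contactSet ψ n) (hT' : ∀ n, T' n ∈ contactSet ψ' n)
    (h : lam.map T = lam.map T') : ∀ᵐ n ∂lam, T' n ∈ contactSet ψ n := by
  have h1 := dualEnergy_le_of_contact (ψ := ψ) hTm' hT'
  have h2 := dualEnergy_le_of_contact (ψ := ψ') hTm hT
  rw [h] at h2
  -- The excess over the optimal slack is nonnegative; equal energies make it vanish almost
  -- everywhere.
  have h3 : ∫ n, ((logSupport ψ n - ψ (T' n)) - (logSupport ψ' n - ψ' (T' n))) ∂lam = 0 := by
    rw [integral_sub (integrable_logSupport_sub hTm' _) (integrable_logSupport_sub hTm' _),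
      integral_logSupport_sub hTm', integral_logSupport_sub hTm', le_antisymm h1 h2, sub_self]
  rw [integral_eq_zero_iff_of_nonneg (fun n => sub_nonneg.2 (logSupport_sub_le (hT' n)))
    ((integrable_logSupport_sub hTm' _).sub (integrable_logSupport_sub hTm' _))] at h3
  filter_upwards [h3] with n hn
  have hn' : (logSupport ψ n - ψ (T' n)) - (logSupport ψ' n - ψ' (T' n)) = 0 := hn
  refine mem_contactSet_of_logSupport_le (inner_pos_of_mem_contactSet (hT' n)) ?_
  linarith [logSupport_eq_of_mem_contactSet (hT' n)]

end uniqueness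

/-- Existence for the Gauss image problem under the weak Aleksandrov condition, and uniqueness of
the multivalued map `G_K ∘ ρ_K` up to `λ`-null sets. In the existence part it is also asserted that
the images of Borel sets are measurable for the completion of `λ`. -/
theorem theorem1p1 (m : ℕ) (lam mu : Measure (Sph m))
    [IsProbabilityMeasure lam] [IsProbabilityMeasure mu]
    (hlam : lam ≪ sphereMeasure m) :
    (¬ ConcentratedOnClosedHemisphere mu → WeakAleksandrov lam mu →
      ∃ K : ConvexBody (Space m), SolvesGaussImage lam mu K ∧
        ∀ ω : Set (Sph m), MeasurableSet ω → NullMeasurableSet (gaussImage K ω) lam) ∧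
    (∀ K L : ConvexBody (Space m), SolvesGaussImage lam mu K → SolvesGaussImage lam mu L →
      ∀ ω : Set (Sph m), MeasurableSet ω →
        lam (symmDiff (gaussImage K ω) (gaussImage L ω)) = 0) := by
  constructor
  · intro hmu hA
    obtain ⟨d, hd, hF⟩ := exists_forall_isClosed_le hlam hmu hA
    obtain ⟨ψ, T, hTm, hT, hmap⟩ := exists_potential hlam hd hF
    obtain ⟨K, hK, hsub⟩ := exists_convexBody_contactSet_subset ψ
    obtain ⟨S, hSm, hS, huniq⟩ := exists_transportMap hlam (logRadial hK)
    -- Contacts of `ψ` are contacts of the body, and those are almost everywhere unique.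
    have hTS : T =ᵐ[lam] S := by
      filter_upwards [huniq] with n hn
      exact hn _ (hsub n (hT n))
    rw [Measure.map_congr hTS] at hmap
    refine ⟨K, ⟨hK, fun ω hω => ?_⟩, fun ω hω =>
      (hSm.nullMeasurable hω).congr (gaussImage_ae_eq hK hS huniq ω).symm⟩
    rw [measure_congr (gaussImage_ae_eq hK hS huniq ω), hmap,
      Measure.map_apply_of_aemeasurable hSm hω]
  · rintro K L ⟨hK, hKmu⟩ ⟨hL, hLmu⟩ ω -
    obtain ⟨T, hTm, hT, hTuniq⟩ := exists_transportMap hlam (logRadial hK)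
    obtain ⟨S, hSm, hS, hSuniq⟩ := exists_transportMap hlam (logRadial hL)
    have hmap : lam.map T = lam.map S := by
      ext B hB
      rw [Measure.map_apply_of_aemeasurable hTm hB, Measure.map_apply_of_aemeasurable hSm hB,
        ← measure_congr (gaussImage_ae_eq hK hT hTuniq B),
        ← measure_congr (gaussImage_ae_eq hL hS hSuniq B), ← hKmu B hB, hLmu B hB]
    have hST : S =ᵐ[lam] T := by
      filter_upwards [hTuniq, ae_mem_contactSet_of_map_eq hTm hSm hT hS hmap] with n h1 h2
      exact h1 _ h2
    rw [measure_symmDiff_eq_zero_iff]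
    refine (gaussImage_ae_eq hK hT hTuniq ω).trans
      (EventuallyEq.trans ?_ (gaussImage_ae_eq hL hS hSuniq ω).symm)
    filter_upwards [hST] with n hn
    refine propext ?_
    change T n ∈ ω ↔ S n ∈ ω
    rw [hn]
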